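/- Let $k\ge 1$, let $a_1,\dots,a_k,\ b_1,\dots,b_k,\ c_1,\dots,c_k\in\mathbb C$ be arbitrary, and let $\ell>0$ (the spatial period). Consider the doubly infinite tridiagonal matrix with diagonal entries $a_i$, entries $b_i$ in positions $(i,i+1)$ and entries $c_i$ in positions $(i+1,i)$ ($i\in\mathbb Z$), where all indices of $a,b,c$ are read modulo $k$. Let $L(a)$ be the bounded operator it defines on $\ell^2(\mathbb Z,\mathbb C)$ (the tridiagonal $k$-Laurent operator), and for $m\ge 1$ let $T_{mk}(a)$ be its $mk\times mk$ section on the indices $1,\dots,mk$ (the tridiagonal $k$-Toeplitz matrix). Let $C_{mk}(a)$ be the tridiagonal $k$-circulant matrix, obtained from $T_{mk}(a)$ by adding $c_k$ to the entry in the first row and last column and $b_k$ to the entry in the last row and first column (for $mk\ge 3$ these two entries of $T_{mk}(a)$ are $0$). For $z\in\mathbb C\setminus\{0\}$ let the symbol $a(z)\in\mathbb C^{k\times k}$ be the matrix obtained from $T_{1\cdot k}(a)$ by adding $c_k z$ to the entry in the first row and last column and $b_k z^{-1}$ to the entry in the last row and first column. Let $Y^*=[-\pi/\ell,\pi/\ell)$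 be the real Brillouin zone, and let $\sigma$ denote the spectrum. Then: 1. for every $m\ge1$, $$\sigma(C_{mk}(a))=\bigcup_{j=0}^{m-1}\sigma\big(a(e^{2\pi \mathrm i j/m})\big);$$ 2. as $m\to\infty$, the sets $\sigma(C_{mk}(a))$ converge in the Hausdorff distance to $\bigcup_{\alpha\in Y^*}\sigma\big(a(e^{-\mathrm i\ell\alpha})\big)$; 3. $$\bigcup_{\alpha\in Y^*}\sigma\big(a(e^{-\mathrm i\ell\alpha})\big)=\sigma(L(a)).$$ -/

import Mathlib

open scoped ENNReal

/-- The position of the site `n : ℤ` in its unit cell of `k` sites. -/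
def siteIndex (k : ℕ) [NeZero k] (n : ℤ) : Fin k :=
  ⟨(n % (k : ℤ)).toNat, by
    have hk : (0 : ℤ) < k := by exact_mod_cast Nat.pos_of_ne_zero (NeZero.ne k)
    have h1 := Int.emod_nonneg n hk.ne'
    have h2 := Int.emod_lt_of_pos n hk
    omega⟩

/-- The last position in a unit cell of `k` sites. -/
def lastSite (k : ℕ) [NeZero k] : Fin k :=
  ⟨k - 1, by have := Nat.pos_of_ne_zero (NeZero.ne k); omega⟩

/-- Entries of the doubly infinite `k`-periodic tridiagonal matrix: the diagonal runs through
`a 0, …, a (k-1)`, the superdiagonal (entries `(i, i+1)`) through `b 0, …, b (k-1)` and the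
subdiagonal (entries `(i+1, i)`) through `c 0, …, c (k-1)`, all repeated with period `k`. -/
def tridiagEntry {k : ℕ} [NeZero k] (a b c : Fin k → ℂ) (i j : ℤ) : ℂ :=
  if j = i then a (siteIndex k i)
  else if j = i + 1 then b (siteIndex k i)
  else if i = j + 1 then c (siteIndex k j)
  else 0

/-- The tridiagonal `k`-Toeplitz matrix of order `m * k`: the upper left corner of the
semi-infinite tridiagonal `k`-Toeplitz operator. -/
def toeplitzMatrix {k : ℕ} [NeZero k] (a b c : Fin k → ℂ) (m : ℕ) :
    Matrix (Fin (m * k)) (Fin (m * k)) ℂ :=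
  Matrix.of fun i j => tridiagEntry a b c (i.val : ℤ) (j.val : ℤ)

/-- The tridiagonal `k`-circulant matrix of order `m * k`: the `k`-Toeplitz matrix with the last
`c` placed in the upper right corner and the last `b` in the lower left corner. They are added to
what is there, which matters only for `m * k ≤ 2`, see `circulantMatrix_apply`. -/
def circulantMatrix {k : ℕ} [NeZero k] (a b c : Fin k → ℂ) (m : ℕ) :
    Matrix (Fin (m * k)) (Fin (m * k)) ℂ :=
  Matrix.of fun i j => toeplitzMatrix a b c m i j
    + (if i.val = 0 ∧ j.val + 1 = m * k then c (lastSite k) else 0)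
    + (if i.val + 1 = m * k ∧ j.val = 0 then b (lastSite k) else 0)

/-- For `m * k ≥ 3` the corner entries of the circulant matrix replace zeros. -/
theorem circulantMatrix_apply {k : ℕ} [NeZero k] (a b c : Fin k → ℂ) (m : ℕ) (h : 3 ≤ m * k)
    (i j : Fin (m * k)) :
    circulantMatrix a b c m i j =
      if i.val = 0 ∧ j.val + 1 = m * k then c (lastSite k)
      else if i.val + 1 = m * k ∧ j.val = 0 then b (lastSite k)
      else toeplitzMatrix a b c m i j := by
  simp only [circulantMatrix, toeplitzMatrix, tridiagEntry, Matrix.of_apply]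
  split_ifs <;> first | omega | simp

/-- The symbol `a(z)` of the tridiagonal `k`-Toeplitz (or Laurent) operator: one `k × k` unit cell
of the tridiagonal matrix, with the last `c` times `z` added in the upper right corner and the last
`b` times `z⁻¹` added in the lower left corner. -/
noncomputable def symbol {k : ℕ} [NeZero k] (a b c : Fin k → ℂ) (z : ℂ) :
    Matrix (Fin k) (Fin k) ℂ :=
  Matrix.of fun i j => tridiagEntry a b c (i.val : ℤ) (j.val : ℤ)
    + (if i.val = 0 ∧ j.val + 1 = k then c (lastSite k) * z else 0)
    + (if i.val + 1 = k ∧ j.val = 0 then b (lastSite k) * z⁻¹ else 0)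

theorem siteIndex_block {k : ℕ} [NeZero k] (n : ℤ) (i : Fin k) :
    siteIndex k (n * k + i.val) = i := by
  apply Fin.ext
  simp only [siteIndex]
  rw [Int.add_comm, Int.add_mul_emod_self_right, Int.emod_eq_of_lt (by omega) (by omega)]
  simp

theorem integral_exp_int (q : ℤ) :
    ∫ θ in (0 : ℝ)..(2 * Real.pi), Complex.exp (Complex.I * q * θ) =
      if q = 0 then 2 * Real.pi else 0 := by
  split_ifs with h
  · simp [h]
  · have hq : Complex.I * q ≠ 0 := mul_ne_zero Complex.I_ne_zero (by exact_mod_cast h)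
    rw [integral_exp_mul_complex hq]
    have : Complex.exp (Complex.I * q * ((2 * Real.pi : ℝ) : ℂ)) = 1 := by
      rw [Complex.exp_eq_one_iff]
      exact ⟨q, by push_cast; ring⟩
    rw [this]
    simp

/-- The matrix with entries `tridiagEntry a b c` has the symbol `symbol a b c`: its `k × k` blocks
along the `n`-th block diagonal are the `n`-th Fourier coefficient of the symbol. -/
theorem fourierCoeff_symbol {k : ℕ} [NeZero k] (a b c : Fin k → ℂ) (n : ℤ) (i j : Fin k) :
    (1 / (2 * Real.pi) : ℂ) * ∫ θ in (0 : ℝ)..(2 * Real.pi),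
        symbol a b c (Complex.exp (Complex.I * θ)) i j * Complex.exp (-Complex.I * n * θ) =
      tridiagEntry a b c (n * k + i.val) j.val := by
  set A : ℂ := tridiagEntry a b c (i.val : ℤ) (j.val : ℤ) with hA
  set B : ℂ := if i.val = 0 ∧ j.val + 1 = k then c (lastSite k) else 0 with hB
  set D : ℂ := if i.val + 1 = k ∧ j.val = 0 then b (lastSite k) else 0 with hD
  have hint (q : ℤ) (u : ℂ) : IntervalIntegrable
      (fun θ : ℝ => u * Complex.exp (Complex.I * q * θ)) MeasureTheory.volume 0 (2 * Real.pi) :=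
    Continuous.intervalIntegrable (by fun_prop) _ _
  have hexp (θ : ℝ) :
      symbol a b c (Complex.exp (Complex.I * θ)) i j * Complex.exp (-Complex.I * n * θ) =
        A * Complex.exp (Complex.I * (-n : ℤ) * θ) + B * Complex.exp (Complex.I * (1 - n : ℤ) * θ)
          + D * Complex.exp (Complex.I * (-1 - n : ℤ) * θ) := by
    have h1 : Complex.exp (Complex.I * (1 - n : ℤ) * θ) =
        Complex.exp (Complex.I * θ) * Complex.exp (-Complex.I * n * θ) := by
      rw [← Complex.exp_add]; congr 1; push_cast; ring
    have h2 : Complex.exp (Complex.I * (-1 - n : ℤ) * θ) =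
        (Complex.exp (Complex.I * θ))⁻¹ * Complex.exp (-Complex.I * n * θ) := by
      rw [← Complex.exp_neg, ← Complex.exp_add]; congr 1; push_cast; ring
    have h3 : Complex.exp (Complex.I * (-n : ℤ) * θ) = Complex.exp (-Complex.I * n * θ) := by
      congr 1; push_cast; ring
    rw [h1, h2, h3]
    simp only [symbol, Matrix.of_apply, hA, hB, hD]
    split_ifs <;> ring
  simp_rw [hexp]
  rw [intervalIntegral.integral_add ((hint _ _).add (hint _ _)) (hint _ _),
    intervalIntegral.integral_add (hint _ _) (hint _ _)]
  simp_rw [intervalIntegral.integral_const_mul, integral_exp_int]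
  have hpi : (Real.pi : ℂ) ≠ 0 := by exact_mod_cast Real.pi_ne_zero
  have hi := i.isLt
  have hj := j.isLt
  have hs := siteIndex_block n i
  have hs0 : siteIndex k (j.val : ℤ) = j := by simpa using siteIndex_block 0 j
  have hl (s : Fin k) (h : s.val + 1 = k) : s = lastSite k := Fin.ext (by simp [lastSite]; omega)
  rcases lt_trichotomy n 0 with hn | hn | hn
  · by_cases h1 : n = -1
    · subst h1
      norm_num
      field_simp
      simp only [hD, tridiagEntry]
      rw [show (-1 : ℤ) * k + i.val = -(k : ℤ) + i.val by ring] at hs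
      rw [hs]
      split_ifs with h2 h3 h4 h5 h6 h7 <;> first | omega | rw [hl i (by omega)] | rfl
    · have hk : n * k ≤ -2 * k := mul_le_mul_of_nonneg_right (by omega) (by omega)
      rw [if_neg (by omega), if_neg (by omega), if_neg (by omega), tridiagEntry,
        if_neg (by omega), if_neg (by omega), if_neg (by omega)]
      simp
  · subst hn
    norm_num
    field_simp
    simp [hA]
  · by_cases h1 : n = 1
    · subst h1
      norm_num
      field_simp
      simp only [hB, tridiagEntry]
      rw [hs0]
      split_ifs <;> first | omega | rw [hl j (by omega)] | rfl
    · have hk : 2 * k ≤ n * k := mul_le_mul_of_nonneg_right (by omega) (by omega)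
      rw [if_neg (by omega), if_neg (by omega), if_neg (by omega), tridiagEntry,
        if_neg (by omega), if_neg (by omega), if_neg (by omega)]
      simp

theorem tridiagEntry_bound {k : ℕ} [NeZero k] (a b c : Fin k → ℂ) :
    ∃ C : ℝ, 0 ≤ C ∧ ∀ i j, ‖tridiagEntry a b c i j‖ ≤ C := by
  refine ⟨∑ s, ‖a s‖ + ∑ s, ‖b s‖ + ∑ s, ‖c s‖, by positivity, fun i j => ?_⟩
  have h (f : Fin k → ℂ) (s : Fin k) : ‖f s‖ ≤ ∑ s, ‖f s‖ :=
    Finset.single_le_sum (f := fun s => ‖f s‖) (fun _ _ => norm_nonneg _) (Finset.mem_univ s)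
  have h0 (f : Fin k → ℂ) : 0 ≤ ∑ s, ‖f s‖ := by positivity
  have := h0 a; have := h0 b; have := h0 c
  unfold tridiagEntry
  split_ifs
  · linarith [h a (siteIndex k i)]
  · linarith [h b (siteIndex k i)]
  · linarith [h c (siteIndex k j)]
  · simp only [norm_zero]; linarith

/-- A weighted shift of a square-summable sequence is square-summable, with a norm bound. -/
theorem weightedShift_aux (d : ℤ → ℂ) (C : ℝ) (hC : 0 ≤ C) (hd : ∀ n, ‖d n‖ ≤ C) (s : ℤ)
    (x : lp (fun _ : ℤ => ℂ) 2) :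
    ∃ y : lp (fun _ : ℤ => ℂ) 2, (∀ n, y n = d n * x (n + s)) ∧ ‖y‖ ≤ C * ‖x‖ := by
  have h2 : (0 : ℝ) < (2 : ℝ≥0∞).toReal := by norm_num
  have hx : HasSum (fun n => ‖x n‖ ^ (2 : ℝ≥0∞).toReal) (‖x‖ ^ (2 : ℝ≥0∞).toReal) :=
    lp.hasSum_norm h2 x
  have hs : HasSum (fun n => C ^ (2 : ℝ≥0∞).toReal * ‖x (n + s)‖ ^ (2 : ℝ≥0∞).toReal)
      (C ^ (2 : ℝ≥0∞).toReal * ‖x‖ ^ (2 : ℝ≥0∞).toReal) :=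
    ((Equiv.addRight s).hasSum_iff.mpr hx).mul_left _
  have hle (n : ℤ) : ‖d n * x (n + s)‖ ^ (2 : ℝ≥0∞).toReal ≤
      C ^ (2 : ℝ≥0∞).toReal * ‖x (n + s)‖ ^ (2 : ℝ≥0∞).toReal := by
    rw [← Real.mul_rpow hC (norm_nonneg _), norm_mul]
    exact Real.rpow_le_rpow (by positivity)
      (mul_le_mul_of_nonneg_right (hd n) (norm_nonneg _)) h2.le
  have hmem : Memℓp (E := fun _ : ℤ => ℂ) (fun n => d n * x (n + s)) 2 :=
    memℓp_gen (Summable.of_nonneg_of_le (fun n => by positivity) hle hs.summable)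
  refine ⟨⟨_, hmem⟩, fun n => rfl, ?_⟩
  refine lp.norm_le_of_tsum_le h2 (by positivity) ?_
  rw [Real.mul_rpow hC (norm_nonneg _), ← hs.tsum_eq]
  exact Summable.tsum_le_tsum hle
    (Summable.of_nonneg_of_le (fun n => by positivity) hle hs.summable) hs.summable

theorem laurent_aux {k : ℕ} [NeZero k] (a b c : Fin k → ℂ) :
    ∃ C : ℝ, ∀ x : lp (fun _ : ℤ => ℂ) 2, ∃ y : lp (fun _ : ℤ => ℂ) 2,
      (∀ n, y n = ∑ j ∈ Finset.Icc (n - 1) (n + 1), tridiagEntry a b c n j * x j) ∧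
        ‖y‖ ≤ C * ‖x‖ := by
  obtain ⟨C, hC, h⟩ := tridiagEntry_bound a b c
  refine ⟨C + C + C, fun x => ?_⟩
  obtain ⟨u, hu, hu'⟩ :=
    weightedShift_aux (fun n => tridiagEntry a b c n (n + (-1))) C hC (fun n => h _ _) (-1) x
  obtain ⟨v, hv, hv'⟩ :=
    weightedShift_aux (fun n => tridiagEntry a b c n (n + 0)) C hC (fun n => h _ _) 0 x
  obtain ⟨w, hw, hw'⟩ :=
    weightedShift_aux (fun n => tridiagEntry a b c n (n + 1)) C hC (fun n => h _ _) 1 x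
  refine ⟨u + v + w, fun n => ?_, ?_⟩
  · have hI : Finset.Icc (n - 1) (n + 1) = {n + (-1), n + 0, n + 1} := by
      ext j; simp only [Finset.mem_Icc, Finset.mem_insert, Finset.mem_singleton]; omega
    rw [hI, Finset.sum_insert (by simp), Finset.sum_insert (by simp), Finset.sum_singleton,
      lp.coeFn_add, lp.coeFn_add, Pi.add_apply, Pi.add_apply, hu, hv, hw]
    ring
  · have := norm_add₃_le (a := u) (b := v) (c := w)
    linarith

/-- The tridiagonal `k`-Laurent operator `L(a)`: the bounded operator on `ℓ²(ℤ, ℂ)` given by the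
doubly infinite matrix `tridiagEntry a b c`, whose row `n` vanishes outside `n - 1, n, n + 1`. -/
noncomputable def laurentOperator {k : ℕ} [NeZero k] (a b c : Fin k → ℂ) :
    lp (fun _ : ℤ => ℂ) 2 →L[ℂ] lp (fun _ : ℤ => ℂ) 2 :=
  LinearMap.mkContinuousOfExistsBound
    { toFun := fun x =>
        ⟨fun n => ∑ j ∈ Finset.Icc (n - 1) (n + 1), tridiagEntry a b c n j * x j, by
          obtain ⟨C, hC⟩ := laurent_aux a b c
          obtain ⟨y, hy, -⟩ := hC x
          rw [← funext hy]
          exact y.2⟩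
      map_add' := fun x y => by
        ext n
        change ∑ j ∈ Finset.Icc (n - 1) (n + 1), tridiagEntry a b c n j * (x j + y j) =
          ∑ j ∈ Finset.Icc (n - 1) (n + 1), tridiagEntry a b c n j * x j +
          ∑ j ∈ Finset.Icc (n - 1) (n + 1), tridiagEntry a b c n j * y j
        simp only [mul_add, Finset.sum_add_distrib]
      map_smul' := fun r x => by
        ext n
        simp [Finset.mul_sum, mul_left_comm] }
    (by
      obtain ⟨C, hC⟩ := laurent_aux a b c
      refine ⟨C, fun x => ?_⟩
      obtain ⟨y, hy, hy'⟩ := hC x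
      refine le_of_eq_of_le (congrArg norm (lp.ext ?_)) hy'
      exact (funext hy).symm)

theorem laurentOperator_apply {k : ℕ} [NeZero k] (a b c : Fin k → ℂ)
    (x : lp (fun _ : ℤ => ℂ) 2) (n : ℤ) :
    laurentOperator a b c x n =
      ∑ j ∈ Finset.Icc (n - 1) (n + 1), tridiagEntry a b c n j * x j := rfl

/-- The (real, first) Brillouin zone `[-π/ℓ, π/ℓ)` for the spatial period `ℓ`. -/
noncomputable def brillouinZone (ℓ : ℝ) : Set ℝ := Set.Ico (-Real.pi / ℓ) (Real.pi / ℓ)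

/-!
Grouping the sites into cells of length `k` makes both operators block Laurent: they are the symbol
`a₀ + a₋₁ z + a₁ z⁻¹` with `z` replaced by a unitary `u`, namely the cyclic shift of `ℂᵐ` for the
circulant matrix and the bilateral shift of `ℓ²(ℤ)` for the Laurent operator. Since the continuous
functional calculus of `u` is an isometric homomorphism, such a matrix over the C⋆-algebra is
invertible exactly when the symbol is invertible at every point of the spectrum of `u`, so that its
spectrum is the union of the spectra of the symbol over `σ(u)`. For the cyclic shift `σ(u)` is the
set of `m`-th roots of unity, for the bilateral shift the unit circle. The convergence holds because
the roots of unity fill the circle and the spectrum of a matrix is uniformly continuous along a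
compact family: a monic polynomial of degree `n` whose value at `μ` is less than `ε ^ n` has a root
within `ε` of `μ`.
-/

section FunctionalCalculus

theorem spectrum_matrix_continuousMap {X 𝕜 n : Type*} [TopologicalSpace X] [RCLike 𝕜]
    [Fintype n] [DecidableEq n] (A : Matrix n n C(X, 𝕜)) :
    spectrum 𝕜 A = ⋃ x, spectrum 𝕜 (A.map fun f => f x) := by
  ext μ
  have hdet (x : X) : (algebraMap 𝕜 (Matrix n n C(X, 𝕜)) μ - A).det x =
      (algebraMap 𝕜 (Matrix n n 𝕜) μ - A.map fun f => f x).det := by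
    let ev : C(X, 𝕜) →ₐ[𝕜] 𝕜 := ContinuousMap.evalAlgHom 𝕜 𝕜 x
    have h := ev.map_det (algebraMap 𝕜 (Matrix n n C(X, 𝕜)) μ - A)
    rwa [map_sub, AlgHom.commutes] at h
  simp only [Set.mem_iUnion, spectrum.mem_iff, Matrix.isUnit_iff_isUnit_det,
    ContinuousMap.isUnit_iff_forall_ne_zero, isUnit_iff_ne_zero, not_forall, hdet]

theorem sum_mul_ne_one_of_isometry {X 𝕜 B ι : Type*} [TopologicalSpace X] [CompactSpace X]
    [RCLike 𝕜] [NormedRing B] [NormedAlgebra 𝕜 B] {φ : C(X, 𝕜) →ₐ[𝕜] B} (hφ : Isometry φ)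
    [Fintype ι] (b : ι → B) {g : ι → C(X, 𝕜)} {x : X} (hg : ∀ i, g i x = 0) :
    ∑ i, b i * φ (g i) ≠ 1 := by
  intro hsum
  have hnorm := hφ.norm_map_of_map_zero (map_zero φ)
  obtain ⟨ε, hε, hbε⟩ : ∃ ε > 0, (∑ i, ‖b i‖) * ε < 1 :=
    ⟨(∑ i, ‖b i‖ + 1)⁻¹, by positivity, by
      rw [← div_eq_mul_inv, div_lt_one (by positivity)]; exact lt_add_one _⟩
  -- `e` peaks at `x` with value `1`, and `‖g i * e‖ ≤ ε` for every `i`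
  let e : C(X, 𝕜) := ⟨fun y => ((ε / (ε + ∑ i, ‖g i y‖) : ℝ) : 𝕜),
    RCLike.continuous_ofReal.comp <| continuous_const.div (by fun_prop) fun y => by positivity⟩
  have hge (i : ι) : ‖g i * e‖ ≤ ε := by
    refine (ContinuousMap.norm_le _ hε.le).2 fun y => ?_
    have hle : ‖g i y‖ ≤ ε + ∑ j, ‖g j y‖ :=
      (Finset.single_le_sum (fun j _ => norm_nonneg (g j y)) (Finset.mem_univ i)).trans
        (le_add_of_nonneg_left hε.le)
    calc ‖(g i * e) y‖ = ‖g i y‖ * (ε / (ε + ∑ j, ‖g j y‖)) := by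
          rw [ContinuousMap.mul_apply, norm_mul]
          simp only [e, ContinuousMap.coe_mk, RCLike.norm_ofReal]
          rw [abs_of_nonneg (by positivity)]
      _ = ε * (‖g i y‖ / (ε + ∑ j, ‖g j y‖)) := by ring
      _ ≤ ε := mul_le_of_le_one_right hε.le (div_le_one_of_le₀ hle (by positivity))
  have hone : 1 ≤ ‖e‖ := by
    have hex : e x = 1 := by simp [e, hg, hε.ne']
    simpa [hex] using e.norm_coe_le_norm x
  refine (hone.trans ?_).not_gt hbε
  calc ‖e‖ = ‖∑ i, b i * φ (g i * e)‖ := by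
        simp_rw [map_mul, ← mul_assoc, ← Finset.sum_mul, hsum, one_mul, hnorm]
    _ ≤ ∑ i, ‖b i‖ * ‖g i * e‖ :=
        norm_sum_le_of_le _ fun i _ => (norm_mul_le _ _).trans_eq (by rw [hnorm])
    _ ≤ (∑ i, ‖b i‖) * ε := by
        rw [Finset.sum_mul]
        exact Finset.sum_le_sum fun i _ => mul_le_mul_of_nonneg_left (hge i) (norm_nonneg _)

theorem isUnit_matrix_map_iff_of_isometry {X 𝕜 B n : Type*} [TopologicalSpace X] [CompactSpace X]
    [RCLike 𝕜] [NormedRing B] [NormedAlgebra 𝕜 B] {φ : C(X, 𝕜) →ₐ[𝕜] B} (hφ : Isometry φ)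
    [Fintype n] [DecidableEq n] {A : Matrix n n C(X, 𝕜)} : IsUnit (A.map φ) ↔ IsUnit A := by
  refine ⟨fun hunit => ?_, fun hA => hA.map φ.mapMatrix⟩
  by_contra hA
  simp only [Matrix.isUnit_iff_isUnit_det, ContinuousMap.isUnit_iff_forall_ne_zero, not_forall,
    not_not] at hA
  obtain ⟨x, hx⟩ := hA
  let ev : C(X, 𝕜) →+* 𝕜 := ContinuousMap.evalAlgHom 𝕜 𝕜 x
  obtain ⟨v, hv, hAv⟩ : ∃ v ≠ 0, (A.map ev).mulVec v = 0 :=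
    Matrix.exists_mulVec_eq_zero_iff.2 ((ev.map_det A).symm.trans hx)
  obtain ⟨i, hi⟩ := Function.ne_iff.1 hv
  obtain ⟨N, hN⟩ := hunit.exists_left_inv
  -- `g` vanishes at `x`, yet `N` maps `φ ∘ g` to the constant vector `v`
  let g : n → C(X, 𝕜) := A.mulVec (algebraMap 𝕜 _ ∘ v)
  have hg (j : n) : g j x = 0 := (ev.map_mulVec A _ j).trans (congrFun hAv j)
  have hφg : φ ∘ g = (A.map φ).mulVec (algebraMap 𝕜 B ∘ v) := by
    ext j
    refine (φ.toRingHom.map_mulVec A _ j).trans ?_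
    simp [Function.comp_def, Matrix.mulVec, dotProduct]
  have hNg : ∑ j, N i j * φ (g j) = algebraMap 𝕜 B (v i) := calc
    _ = N.mulVec (φ ∘ g) i := rfl
    _ = algebraMap 𝕜 B (v i) := by rw [hφg, Matrix.mulVec_mulVec, hN, Matrix.one_mulVec]; rfl
  refine sum_mul_ne_one_of_isometry hφ (fun j => (v i)⁻¹ • N i j) hg ?_
  rw [← map_one (algebraMap 𝕜 B), ← inv_mul_cancel₀ hi, map_mul, ← hNg, Finset.mul_sum]
  simp_rw [Algebra.smul_def, mul_assoc]

theorem spectrum_matrix_map_of_isometry {X 𝕜 B n : Type*} [TopologicalSpace X] [CompactSpace X]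
    [RCLike 𝕜] [NormedRing B] [NormedAlgebra 𝕜 B] {φ : C(X, 𝕜) →ₐ[𝕜] B} (hφ : Isometry φ)
    [Fintype n] [DecidableEq n] (A : Matrix n n C(X, 𝕜)) :
    spectrum 𝕜 (A.map φ) = spectrum 𝕜 A := by
  ext μ
  have hmap : algebraMap 𝕜 _ μ - A.map φ = (algebraMap 𝕜 _ μ - A).map φ := by
    change _ - φ.mapMatrix A = φ.mapMatrix _
    rw [map_sub, AlgHom.commutes]
  rw [spectrum.mem_iff, spectrum.mem_iff, hmap, isUnit_matrix_map_iff_of_isometry hφ]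

theorem spectrum_matrix_map_cfcHom {B n : Type*} [CStarAlgebra B] [Fintype n] [DecidableEq n]
    (u : B) [IsStarNormal u] (A : Matrix n n C(spectrum ℂ u, ℂ)) :
    spectrum ℂ (A.map (cfcHom (p := IsStarNormal) (R := ℂ) (a := u) inferInstance)) =
      ⋃ z, spectrum ℂ (A.map fun f => f z) := by
  rw [← spectrum_matrix_continuousMap]
  exact spectrum_matrix_map_of_isometry (φ := (cfcHom _ : _ →⋆ₐ[ℂ] B).toAlgHom)
    (isometry_cfcHom u) A

end FunctionalCalculus

section HausdorffContinuity

open Metric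
open scoped NNReal Topology

theorem exists_mem_spectrum_nnnorm_sub_lt {𝕜 n : Type*} [NormedField 𝕜] [IsAlgClosed 𝕜]
    [Fintype n] [DecidableEq n] {A : Matrix n n 𝕜} {μ : 𝕜} {ε : ℝ≥0}
    (h : ‖A.charpoly.eval μ‖₊ < ε ^ Fintype.card n) : ∃ ν ∈ spectrum 𝕜 A, ‖μ - ν‖₊ < ε := by
  by_contra! hfar
  have hsplits := IsAlgClosed.splits A.charpoly
  refine h.not_ge ?_
  rw [hsplits.eval_eq_prod_roots_of_monic A.charpoly_monic, ← nnnormHom_apply, map_multiset_prod,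
    ← A.charpoly_natDegree_eq_dim, hsplits.natDegree_eq_card_roots, Multiset.map_map,
    ← Multiset.card_map fun ν => nnnormHom (μ - ν)]
  refine Multiset.pow_card_le_prod fun r hr => ?_
  obtain ⟨ν, hν, rfl⟩ := Multiset.mem_map.1 hr
  exact hfar ν (Matrix.mem_spectrum_iff_isRoot_charpoly.2 (Polynomial.isRoot_of_mem_roots hν))

open scoped Matrix.Norms.Operator in
theorem exists_forall_edist_lt_hausdorffEDist_spectrum_le {X n : Type*} [PseudoEMetricSpace X]
    [Fintype n] [DecidableEq n] {A : X → Matrix n n ℂ} {K : Set X} (hK : IsCompact K)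
    (hA : ContinuousOn A K) {ε : ℝ≥0} (hε : 0 < ε) :
    ∃ δ > 0, ∀ z ∈ K, ∀ w ∈ K, edist z w < δ →
      hausdorffEDist (spectrum ℂ (A z)) (spectrum ℂ (A w)) ≤ ε := by
  obtain ⟨R, hR⟩ : ∃ R, ∀ z ∈ K, ∀ μ ∈ spectrum ℂ (A z), μ ∈ closedBall 0 R := by
    obtain ⟨C, hC⟩ := hK.exists_bound_of_continuousOn hA
    refine ⟨C * ‖(1 : Matrix n n ℂ)‖, fun z hz μ hμ => mem_closedBall_zero_iff.2 ?_⟩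
    exact (spectrum.norm_le_norm_mul_of_mem hμ).trans
      (mul_le_mul_of_nonneg_right (hC z hz) (norm_nonneg _))
  have hcont : ContinuousOn (fun p : X × ℂ => (A p.1).charpoly.eval p.2)
      (K ×ˢ closedBall 0 R) := by
    simp_rw [Matrix.eval_charpoly]
    have hscalar : Continuous (Matrix.scalar n : ℂ → Matrix n n ℂ) :=
      (continuous_pi fun _ => continuous_id).matrix_diagonal
    exact continuous_id.matrix_det.comp_continuousOn
      ((hscalar.comp continuous_snd).continuousOn.sub (hA.comp continuousOn_fst fun p hp => hp.1))
  obtain ⟨δ, hδ, hunif⟩ := EMetric.uniformContinuousOn_iff.1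
    ((hK.prod (isCompact_closedBall 0 R)).uniformContinuousOn_of_continuous hcont)
    (ε ^ Fintype.card n : ℝ≥0) (by positivity)
  have hnear {z w : X} (hz : z ∈ K) (hw : w ∈ K) (hzw : edist z w < δ) (μ : ℂ)
      (hμ : μ ∈ spectrum ℂ (A z)) : ∃ ν ∈ spectrum ℂ (A w), edist μ ν ≤ ε := by
    have hdist := hunif (a := (w, μ)) ⟨hw, hR z hz μ hμ⟩ (b := (z, μ)) ⟨hz, hR z hz μ hμ⟩
      (by simpa [Prod.edist_eq, edist_comm w z] using hzw)
    have hroot : (A z).charpoly.eval μ = 0 := Matrix.mem_spectrum_iff_isRoot_charpoly.1 hμ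
    rw [hroot, edist_zero_right, enorm_eq_nnnorm, ENNReal.coe_lt_coe] at hdist
    obtain ⟨ν, hν, hμν⟩ := exists_mem_spectrum_nnnorm_sub_lt hdist
    exact ⟨ν, hν, by rw [edist_nndist, nndist_eq_nnnorm]; exact_mod_cast hμν.le⟩
  exact ⟨δ, hδ, fun z hz w hw hzw => hausdorffEDist_le_of_mem_edist (hnear hz hw hzw)
    (hnear hw hz (edist_comm z w ▸ hzw))⟩

theorem hausdorffEDist_biUnion_le_of_lt {X Y : Type*} [PseudoEMetricSpace X]
    [PseudoEMetricSpace Y] {F : X → Set Y} {s t : Set X} {δ ε : ℝ≥0∞}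
    (hF : ∀ x ∈ s, ∀ y ∈ t, edist x y < δ → hausdorffEDist (F x) (F y) ≤ ε)
    (hst : hausdorffEDist s t < δ) :
    hausdorffEDist (⋃ x ∈ s, F x) (⋃ y ∈ t, F y) ≤ ε := by
  refine hausdorffEDist_le_of_infEDist (fun p hp => ?_) fun p hp => ?_
  · obtain ⟨x, hx, hpx⟩ := Set.mem_iUnion₂.1 hp
    obtain ⟨y, hy, hxy⟩ := exists_edist_lt_of_hausdorffEDist_lt hx hst
    exact (infEDist_anti (Set.subset_biUnion_of_mem hy)).trans
      ((infEDist_le_hausdorffEDist_of_mem hpx).trans (hF x hx y hy hxy))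
  · obtain ⟨y, hy, hpy⟩ := Set.mem_iUnion₂.1 hp
    obtain ⟨x, hx, hyx⟩ :=
      exists_edist_lt_of_hausdorffEDist_lt hy (hausdorffEDist_comm.trans_lt hst)
    rw [edist_comm] at hyx
    exact (infEDist_anti (Set.subset_biUnion_of_mem hx)).trans
      ((infEDist_le_hausdorffEDist_of_mem hpy).trans
        (hausdorffEDist_comm.trans_le (hF x hx y hy hyx)))

theorem tendsto_hausdorffEDist_biUnion_spectrum {X n ι : Type*} [PseudoEMetricSpace X]
    [Fintype n] [DecidableEq n] {A : X → Matrix n n ℂ} {K : Set X} (hK : IsCompact K)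
    (hA : ContinuousOn A K) {l : Filter ι} {Z : ι → Set X} (hZK : ∀ᶠ i in l, Z i ⊆ K)
    (hZ : Filter.Tendsto (fun i => hausdorffEDist (Z i) K) l (𝓝 0)) :
    Filter.Tendsto (fun i => hausdorffEDist (⋃ z ∈ Z i, spectrum ℂ (A z))
      (⋃ z ∈ K, spectrum ℂ (A z))) l (𝓝 0) := by
  refine ENNReal.tendsto_nhds_zero.2 fun ε hε => ?_
  obtain ⟨ε', hε', hε'ε⟩ := ENNReal.lt_iff_exists_nnreal_btwn.1 hε
  obtain ⟨δ, hδ, hσ⟩ := exists_forall_edist_lt_hausdorffEDist_spectrum_le hK hA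
    (ENNReal.coe_pos.1 hε')
  filter_upwards [hZK, hZ.eventually_lt_const hδ] with i hi hiδ
  exact (hausdorffEDist_biUnion_le_of_lt (fun z hz => hσ z (hi hz)) hiδ).trans hε'ε.le

end HausdorffContinuity

section RootsOfUnity

open Metric
open scoped Topology

theorem setOf_pow_eq_one {m : ℕ} (hm : 0 < m) :
    {z : ℂ | z ^ m = 1} =
      (fun j : ℕ => Complex.exp (2 * Real.pi * Complex.I * j / m)) '' Finset.range m := by
  have := NeZero.of_pos hm
  ext z
  have hexp (j : ℕ) : Complex.exp (2 * Real.pi * Complex.I / m) ^ j =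
      Complex.exp (2 * Real.pi * Complex.I * j / m) := by
    rw [← Complex.exp_nat_mul]
    ring_nf
  constructor
  · intro hz
    obtain ⟨j, hj, rfl⟩ := (Complex.isPrimitiveRoot_exp m hm.ne').eq_pow_of_pow_eq_one hz
    exact ⟨j, Finset.mem_coe.2 (Finset.mem_range.2 hj), (hexp j).symm⟩
  · rintro ⟨j, -, rfl⟩
    change Complex.exp (2 * Real.pi * Complex.I * j / m) ^ m = 1
    rw [← hexp, pow_right_comm, (Complex.isPrimitiveRoot_exp m hm.ne').pow_eq_one, one_pow]

theorem exists_pow_eq_one_dist_le {z : ℂ} (hz : ‖z‖ = 1) {m : ℕ} (hm : 0 < m) :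
    ∃ w : ℂ, w ^ m = 1 ∧ dist z w ≤ Real.pi / m := by
  have hm0 : (m : ℂ) ≠ 0 := Nat.cast_ne_zero.2 hm.ne'
  let r : ℤ := round (m * z.arg / (2 * Real.pi))
  let φ : ℝ := 2 * Real.pi * r / m
  have hφ : |z.arg - φ| ≤ Real.pi / m := by
    have hr := abs_sub_round (m * z.arg / (2 * Real.pi))
    have hdiff : z.arg - φ = 2 * Real.pi / m * (m * z.arg / (2 * Real.pi) - r) := by
      simp only [φ]
      field_simp
    rw [hdiff, abs_mul, abs_of_nonneg (by positivity)]
    calc _ ≤ 2 * Real.pi / m * (1 / 2) := by gcongr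
      _ = Real.pi / m := by ring
  have hw : ‖Complex.exp (Complex.I * φ)‖ = 1 := Complex.norm_exp_I_mul_ofReal φ
  have hzw : z = Complex.exp (Complex.I * φ) * Complex.exp (Complex.I * (z.arg - φ : ℝ)) := by
    rw [← Complex.exp_add, Complex.ofReal_sub, ← mul_add, add_sub_cancel, mul_comm]
    simpa [hz] using (Complex.norm_mul_exp_arg_mul_I z).symm
  refine ⟨Complex.exp (Complex.I * φ), ?_, ?_⟩
  · rw [← Complex.exp_nat_mul, ← Complex.exp_int_mul_two_pi_mul_I r]
    simp only [φ]
    push_cast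
    field_simp
  · nth_rw 1 [dist_eq_norm, hzw, ← mul_sub_one, norm_mul, hw, one_mul]
    exact Real.norm_exp_I_mul_ofReal_sub_one_le.trans hφ

theorem setOf_pow_eq_one_subset_sphere {m : ℕ} (hm : 0 < m) :
    {z : ℂ | z ^ m = 1} ⊆ sphere 0 1 := fun _ hz =>
  mem_sphere_zero_iff_norm.2 (Complex.norm_eq_one_of_pow_eq_one hz hm.ne')

theorem tendsto_hausdorffEDist_setOf_pow_eq_one :
    Filter.Tendsto (fun m : ℕ => hausdorffEDist {z : ℂ | z ^ m = 1} (sphere 0 1))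
      Filter.atTop (𝓝 0) := by
  have hlim : Filter.Tendsto (fun m : ℕ => ENNReal.ofReal (Real.pi / m)) Filter.atTop (𝓝 0) := by
    simpa using ENNReal.tendsto_ofReal (tendsto_const_div_atTop_nhds_zero_nat Real.pi)
  refine tendsto_of_tendsto_of_tendsto_of_le_of_le' tendsto_const_nhds hlim (by simp) ?_
  filter_upwards [Filter.eventually_gt_atTop 0] with m hm
  refine hausdorffEDist_le_of_mem_edist
    (fun z hz => ⟨z, setOf_pow_eq_one_subset_sphere hm hz, by simp⟩) fun z hz => ?_
  obtain ⟨w, hw, hzw⟩ := exists_pow_eq_one_dist_le (mem_sphere_zero_iff_norm.1 hz) hm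
  exact ⟨w, hw, by rw [edist_dist]; exact ENNReal.ofReal_le_ofReal hzw⟩

end RootsOfUnity

section Sequences

open scoped lp

variable {α β ι E : Type*} {p : ℝ≥0∞} [NormedAddCommGroup E]

theorem memℓp_comp_of_injective {f : α → E} (hf : Memℓp f p) {g : β → α}
    (hg : Function.Injective g) : Memℓp (E := fun _ => E) (f ∘ g) p := by
  obtain (rfl | rfl | hp) := p.trichotomy
  · exact memℓp_zero (hf.finite_dsupport.preimage hg.injOn)
  · exact memℓp_infty (hf.bddAbove.mono (Set.range_comp_subset_range g fun a => ‖f a‖))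
  · exact memℓp_gen ((hf.summable hp).comp_injective hg)

theorem memℓp_of_forall_memℓp_prod_mk [Finite ι] {f : α × ι → E}
    (hf : ∀ i, Memℓp (fun a => f (a, i)) p) : Memℓp f p := by
  obtain (rfl | rfl | hp) := p.trichotomy
  · refine memℓp_zero ((Set.finite_iUnion fun i =>
      (hf i).finite_dsupport.image fun a => (a, i)).subset fun x hx => ?_)
    exact Set.mem_iUnion.2 ⟨x.2, x.1, hx, rfl⟩
  · have hbdd : BddAbove (⋃ i ∈ Set.univ, Set.range fun a => ‖f (a, i)‖) :=
      (Set.finite_univ.bddAbove_biUnion).2 fun i _ => (hf i).bddAbove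
    refine memℓp_infty (hbdd.mono ?_)
    rintro _ ⟨⟨a, i⟩, rfl⟩
    exact Set.mem_biUnion (Set.mem_univ i) ⟨a, rfl⟩
  · refine memℓp_gen ((Equiv.prodComm ι α).summable_iff.1 ?_)
    exact (summable_prod_of_nonneg fun _ => Real.rpow_nonneg (norm_nonneg _) _).2
      ⟨fun i => (hf i).summable hp, .of_finite⟩

theorem norm_lp_comp_le [Fact (1 ≤ p)] (x : ℓ^p(α, E)) {g : β → α} (hg : Function.Injective g) :
    ‖(⟨x ∘ g, memℓp_comp_of_injective (lp.memℓp x) hg⟩ : ℓ^p(β, E))‖ ≤ ‖x‖ := by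
  obtain (rfl | rfl | hp) := p.trichotomy
  · exact absurd (Fact.out : (1 : ℝ≥0∞) ≤ 0) (by simp)
  · exact lp.norm_le_of_forall_le (norm_nonneg x) fun b =>
      lp.norm_apply_le_norm ENNReal.top_ne_zero x (g b)
  · refine lp.norm_le_of_tsum_le hp (norm_nonneg x) ?_
    rw [lp.norm_rpow_eq_tsum hp]
    exact tsum_comp_le_tsum_of_inj ((lp.memℓp x).summable hp) (fun _ => by positivity) hg

theorem eq_zero_of_forall_norm_lp_eq [Infinite β] (hp : 0 < p.toReal) {x : ℓ^p(α, E)}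
    {g : β → α} (hg : Function.Injective g) {r : ℝ} (hr : ∀ b, ‖x (g b)‖ = r) : r = 0 := by
  have hsum : Summable fun b => ‖x (g b)‖ ^ p.toReal :=
    ((lp.memℓp x).summable hp).comp_injective hg
  simp_rw [hr, summable_const_iff] at hsum
  obtain ⟨b⟩ := ‹Infinite β›.nonempty
  exact (Real.rpow_eq_zero ((norm_nonneg _).trans_eq (hr b)) hp.ne').1 hsum

section Reindex

variable (𝕜 : Type*) [NormedField 𝕜] [NormedSpace 𝕜 E] [Fact (1 ≤ p)]

/-- Restriction of a sequence along an injective map of the index sets. -/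
noncomputable def lpComp (g : β → α) (hg : Function.Injective g) : ℓ^p(α, E) →L[𝕜] ℓ^p(β, E) :=
  LinearMap.mkContinuous
    { toFun x := ⟨x ∘ g, memℓp_comp_of_injective (lp.memℓp x) hg⟩
      map_add' _ _ := rfl
      map_smul' _ _ := rfl } 1 fun x => (norm_lp_comp_le x hg).trans_eq (one_mul _).symm

/-- Reindexing of sequences along a bijection of the index sets. -/
noncomputable def lpReindex (e : β ≃ α) : ℓ^p(α, E) ≃ₗᵢ[𝕜] ℓ^p(β, E) where
  toFun := lpComp 𝕜 e e.injective
  invFun := lpComp 𝕜 e.symm e.symm.injective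
  map_add' := map_add _
  map_smul' := map_smul _
  left_inv x := lp.ext (funext fun a => congrArg x (e.apply_symm_apply a))
  right_inv x := lp.ext (funext fun b => congrArg x (e.symm_apply_apply b))
  norm_map' x := by
    have hinv : lpComp 𝕜 e.symm e.symm.injective (lpComp 𝕜 e e.injective x) = x :=
      lp.ext (funext fun a => congrArg x (e.apply_symm_apply a))
    refine (norm_lp_comp_le x e.injective).antisymm ?_
    exact (congrArg norm hinv).ge.trans (norm_lp_comp_le _ e.symm.injective)

theorem bijective_pi_lpComp [Finite ι] (e : α × ι ≃ β) :
    Function.Bijective (ContinuousLinearMap.pi fun i =>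
      lpComp 𝕜 (fun a => e (a, i)) (e.injective.comp (Prod.mk_left_injective i)) :
        ℓ^p(β, E) →L[𝕜] (ι → ℓ^p(α, E))) := by
  refine ⟨fun x y hxy => lp.ext (funext fun b => ?_), fun y => ?_⟩
  · obtain ⟨⟨a, i⟩, rfl⟩ := e.surjective b
    exact congrArg (fun z : ι → ℓ^p(α, E) => z i a) hxy
  · have hy : Memℓp (fun q : α × ι => y q.2 q.1) p :=
      memℓp_of_forall_memℓp_prod_mk fun i => lp.memℓp (y i)
    refine ⟨⟨_, memℓp_comp_of_injective hy e.symm.injective⟩, ?_⟩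
    ext i a
    exact congrArg (fun q : α × ι => y q.2 q.1) (e.symm_apply_apply (a, i))

end Reindex

section Block

variable (𝕜 : Type*) [NontriviallyNormedField 𝕜] [NormedSpace 𝕜 E] [CompleteSpace E]
  [Fact (1 ≤ p)] [Finite ι]

/-- A sequence indexed by `α × ι` with `ι` finite, read as an `ι`-tuple of sequences indexed
by `α`. -/
noncomputable def lpBlock (e : α × ι ≃ β) : ℓ^p(β, E) ≃L[𝕜] (ι → ℓ^p(α, E)) :=
  have := Fintype.ofFinite ι
  .ofBijective _ (LinearMap.ker_eq_bot.2 (bijective_pi_lpComp 𝕜 e).1)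
    (LinearMap.range_eq_top.2 (bijective_pi_lpComp 𝕜 e).2)

end Block

end Sequences

section OperatorMatrix

/-- A square matrix of continuous linear operators acts on column vectors. -/
def matrixCLMAlgEquiv (𝕜 E ι : Type*) [NormedField 𝕜] [NormedAddCommGroup E] [NormedSpace 𝕜 E]
    [Fintype ι] [DecidableEq ι] :
    Matrix ι ι (E →L[𝕜] E) ≃ₐ[𝕜] ((ι → E) →L[𝕜] (ι → E)) where
  toFun M := .pi fun i => ∑ j, M i j ∘L .proj j
  invFun T := .of fun i j => .proj i ∘L T ∘L .single 𝕜 (fun _ => E) j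
  left_inv M := by
    ext i j x
    simp [Pi.single_apply, apply_ite]
  right_inv T := by
    ext x i
    simpa [map_sum] using congrArg (fun y => T y i) (Finset.univ_sum_single x)
  map_mul' M N := by
    ext x i
    simpa [Matrix.mul_apply] using Finset.sum_comm
  map_add' M N := by
    ext x i
    simp [Finset.sum_add_distrib]
  commutes' r := by
    ext x i
    simp [Matrix.algebraMap_matrix_apply, Algebra.algebraMap_eq_smul_one,
      DFunLike.ite_apply]

theorem matrixCLMAlgEquiv_apply {𝕜 E ι : Type*} [NormedField 𝕜] [NormedAddCommGroup E]
    [NormedSpace 𝕜 E] [Fintype ι] [DecidableEq ι] (M : Matrix ι ι (E →L[𝕜] E)) (x : ι → E)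
    (i : ι) : matrixCLMAlgEquiv 𝕜 E ι M x i = ∑ j, M i j (x j) := by
  simp [matrixCLMAlgEquiv]

end OperatorMatrix

section Blocks

variable {k : ℕ} [NeZero k] (a b c : Fin k → ℂ)

/-- The `k × k` block of the doubly infinite tridiagonal matrix on the `s`-th block diagonal: the
matrix is block Laurent, so the block in row `q` and column `r` depends on `s = r - q` only. -/
def tridiagBlock (s : ℤ) : Matrix (Fin k) (Fin k) ℂ :=
  Matrix.of fun i j => tridiagEntry a b c i (s * k + j)

theorem siteIndex_mul_add (q n : ℤ) : siteIndex k (q * k + n) = siteIndex k n := by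
  simp [siteIndex]

theorem siteIndex_val (i : Fin k) : siteIndex k (i : ℤ) = i := by
  simpa using siteIndex_block 0 i

theorem tridiagEntry_mul_add (q i j : ℤ) :
    tridiagEntry a b c (q * k + i) (q * k + j) = tridiagEntry a b c i j := by
  simp only [tridiagEntry, siteIndex_mul_add, add_assoc, add_right_inj]

theorem tridiagEntry_block (q r : ℤ) (i j : Fin k) :
    tridiagEntry a b c (q * k + i) (r * k + j) = tridiagBlock a b c (r - q) i j := by
  rw [show r * k + j = q * k + ((r - q) * k + j) by ring, tridiagEntry_mul_add]
  rfl

theorem tridiagBlock_neg_one_apply (i j : Fin k) :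
    tridiagBlock a b c (-1) i j = if i.val = 0 ∧ j.val + 1 = k then c (lastSite k) else 0 := by
  have hj (h : j.val + 1 = k) : j = lastSite k := Fin.ext (by simp [lastSite]; omega)
  simp only [tridiagBlock, Matrix.of_apply, tridiagEntry, siteIndex_mul_add, siteIndex_val]
  split_ifs <;> first | omega | simp_all

theorem tridiagBlock_one_apply (i j : Fin k) :
    tridiagBlock a b c 1 i j = if i.val + 1 = k ∧ j.val = 0 then b (lastSite k) else 0 := by
  have hi (h : i.val + 1 = k) : i = lastSite k := Fin.ext (by simp [lastSite]; omega)
  simp only [tridiagBlock, Matrix.of_apply, tridiagEntry, siteIndex_val]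
  split_ifs <;> first | omega | simp_all

theorem tridiagBlock_eq_zero {s : ℤ} (hs : 1 < |s|) : tridiagBlock a b c s = 0 := by
  ext i j
  have hsk : 2 * (k : ℤ) ≤ |s * k| := by
    rw [abs_mul, Nat.abs_cast]
    exact mul_le_mul_of_nonneg_right hs (by positivity)
  rcases abs_cases (s * (k : ℤ)) with h | h <;>
  · simp only [tridiagBlock, Matrix.of_apply, tridiagEntry, Matrix.zero_apply]
    split_ifs <;> first | omega | rfl

theorem tridiagBlock_eq_ite (s : ℤ) :
    tridiagBlock a b c s = (if s = 0 then tridiagBlock a b c 0 else 0)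
      + (if s = -1 then tridiagBlock a b c (-1) else 0)
      + (if s = 1 then tridiagBlock a b c 1 else 0) := by
  by_cases hs : 1 < |s|
  · rw [tridiagBlock_eq_zero a b c hs]
    grind
  · rw [not_lt, abs_le] at hs
    obtain rfl | rfl | rfl : s = -1 ∨ s = 0 ∨ s = 1 := by omega
    all_goals simp

theorem support_tridiagEntry_subset (n : ℤ) :
    (Function.support fun j => tridiagEntry a b c n j) ⊆ Finset.Icc (n - 1) (n + 1) := by
  intro j hj
  simp only [Function.mem_support, tridiagEntry] at hj
  rw [Finset.coe_Icc, Set.mem_Icc]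
  split_ifs at hj <;> first | omega | exact absurd rfl hj

theorem sum_tridiagEntry_mul (y : ℤ → ℂ) (q : ℤ) (i : Fin k) :
    ∑ n ∈ Finset.Icc (q * k + i - 1) (q * k + i + 1), tridiagEntry a b c (q * k + i) n * y n =
      ∑ j, (tridiagBlock a b c 0 i j * y (q * k + j)
        + tridiagBlock a b c (-1) i j * y ((q - 1) * k + j)
        + tridiagBlock a b c 1 i j * y ((q + 1) * k + j)) := by
  have hblock (p : ℤ × Fin k) : tridiagEntry a b c (q * k + i) ((Int.divModEquiv k).symm p) =
      tridiagBlock a b c (p.1 - q) i p.2 := tridiagEntry_block a b c q p.1 i p.2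
  have hsupp : (Function.support fun p : ℤ × Fin k => tridiagBlock a b c (p.1 - q) i p.2) ⊆
      (({q, q - 1, q + 1} ×ˢ Finset.univ : Finset (ℤ × Fin k)) : Set (ℤ × Fin k)) := by
    intro p hp
    have hs : |p.1 - q| ≤ 1 := by
      by_contra! h
      exact hp (by simp [tridiagBlock_eq_zero a b c h])
    rw [abs_le] at hs
    simp only [Finset.coe_product, Finset.coe_insert, Finset.coe_singleton, Finset.coe_univ,
      Set.mem_prod, Set.mem_insert_iff, Set.mem_singleton_iff, Set.mem_univ, and_true]
    omega
  rw [← finsum_eq_sum_of_support_subset _ ((Function.support_mul_subset_left _ _).trans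
      (support_tridiagEntry_subset a b c _)), ← finsum_comp_equiv (Int.divModEquiv k).symm]
  simp_rw [hblock]
  rw [finsum_eq_sum_of_support_subset _ ((Function.support_mul_subset_left _ _).trans hsupp),
    Finset.sum_product_right]
  refine Finset.sum_congr rfl fun j _ => ?_
  rw [Finset.sum_insert (by grind), Finset.sum_insert (by grind), Finset.sum_singleton]
  simp [Int.divModEquiv, add_assoc]

/-- The symbol evaluated in a `ℂ`-algebra: `u` is substituted for the variable `z` and `v` for its
inverse. A cyclic shift `u` gives the circulant matrix and the bilateral shift of `ℓ²(ℤ)` the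
Laurent operator. -/
noncomputable def symbolAt {B : Type*} [Ring B] [Algebra ℂ B] (u v : B) :
    Matrix (Fin k) (Fin k) B :=
  Matrix.of fun i j => algebraMap ℂ B (tridiagBlock a b c 0 i j)
    + tridiagBlock a b c (-1) i j • u + tridiagBlock a b c 1 i j • v

theorem symbolAt_inv (z : ℂ) : symbolAt a b c z z⁻¹ = symbol a b c z := by
  ext i j
  have h0 : tridiagBlock a b c 0 i j = tridiagEntry a b c i j := by simp [tridiagBlock]
  simp [symbolAt, symbol, tridiagBlock_neg_one_apply, tridiagBlock_one_apply, h0]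

theorem continuousOn_symbol : ContinuousOn (symbol a b c) {0}ᶜ := by
  refine continuousOn_pi.2 fun i => continuousOn_pi.2 fun j => ?_
  simp_rw [← symbolAt_inv, symbolAt, Matrix.of_apply]
  fun_prop (disch := simp_all)

theorem symbolAt_map {B B' : Type*} [Ring B] [Algebra ℂ B] [Ring B'] [Algebra ℂ B']
    (φ : B →ₐ[ℂ] B') (u v : B) :
    (symbolAt a b c u v).map φ = symbolAt a b c (φ u) (φ v) := by
  ext i j
  simp [symbolAt]

theorem spectrum_symbolAt_of_mem_unitary {B : Type*} [CStarAlgebra B] {u : B}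
    (hu : u ∈ unitary B) :
    spectrum ℂ (symbolAt a b c u (star u)) = ⋃ z ∈ spectrum ℂ u, spectrum ℂ (symbol a b c z) := by
  have hnormal : IsStarNormal u := isStarNormal_of_mem_unitary hu
  let ι : C(spectrum ℂ u, ℂ) := ContinuousMap.restrict (spectrum ℂ u) (ContinuousMap.id ℂ)
  have hι : cfcHom hnormal ι = u := cfcHom_id hnormal
  have hmap : (symbolAt a b c ι (star ι)).map (cfcHom hnormal) = symbolAt a b c u (star u) := by
    simpa [hι, map_star] using symbolAt_map a b c (cfcHom hnormal).toAlgHom ι (star ι)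
  have heval (z : spectrum ℂ u) :
      (symbolAt a b c ι (star ι)).map (fun f => f z) = symbol a b c z := by
    have hz : star (z : ℂ) = (z : ℂ)⁻¹ :=
      (Complex.inv_eq_conj (spectrum.norm_eq_one_of_unitary hu z.2)).symm
    rw [← symbolAt_inv, ← hz]
    exact symbolAt_map a b c (ContinuousMap.evalAlgHom ℂ ℂ z) ι (star ι)
  rw [← hmap, spectrum_matrix_map_cfcHom, Set.biUnion_eq_iUnion]
  simp_rw [heval]

end Blocks

section Circulant

variable {k : ℕ} [NeZero k] (a b c : Fin k → ℂ)

/-- The cyclic shift: `(cyclicShift m *ᵥ v) p = v (p - 1)`, with indices modulo `m`. -/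
noncomputable def cyclicShift (m : ℕ) : Matrix (Fin m) (Fin m) ℂ :=
  (finRotate m)⁻¹.permMatrix ℂ

theorem star_cyclicShift (m : ℕ) : star (cyclicShift m) = (finRotate m).permMatrix ℂ := by
  rw [cyclicShift, Matrix.star_eq_conjTranspose, Matrix.conjTranspose_permMatrix, inv_inv]

theorem cyclicShift_mem_unitary (m : ℕ) : cyclicShift m ∈ unitary (Matrix (Fin m) (Fin m) ℂ) := by
  rw [Unitary.mem_iff, star_cyclicShift, cyclicShift, ← Matrix.permMatrix_mul,
    ← Matrix.permMatrix_mul]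
  simp

theorem finRotate_eq_iff {m : ℕ} (p q : Fin m) :
    finRotate m p = q ↔ p.val + 1 = q ∨ p.val + 1 = m ∧ q.val = 0 := by
  obtain _ | m := m
  · exact p.elim0
  · simp only [Fin.ext_iff, coe_finRotate, Fin.val_last]
    split_ifs <;> omega

theorem star_cyclicShift_apply {m : ℕ} (p q : Fin m) :
    star (cyclicShift m) p q = if p.val + 1 = q ∨ p.val + 1 = m ∧ q.val = 0 then 1 else 0 := by
  simp only [star_cyclicShift, Equiv.Perm.permMatrix, PEquiv.toMatrix_apply, ← finRotate_eq_iff,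
    Equiv.toPEquiv_apply, Option.mem_some_iff]

theorem cyclicShift_apply {m : ℕ} (p q : Fin m) :
    cyclicShift m p q = if q.val + 1 = p ∨ q.val + 1 = m ∧ p.val = 0 then 1 else 0 := by
  rw [← star_star (cyclicShift m), Matrix.star_apply, star_cyclicShift_apply, apply_ite star,
    star_one, star_zero]

theorem finProdFinEquiv_add_one_eq_mul_iff {m n : ℕ} (p : Fin m) (i : Fin n) :
    (finProdFinEquiv (p, i)).val + 1 = m * n ↔ p.val + 1 = m ∧ i.val + 1 = n := by
  have hp := p.isLt
  have hi := i.isLt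
  simp only [finProdFinEquiv_apply_val]
  constructor
  · intro h
    have hpm : p.val + 1 = m := by nlinarith
    exact ⟨hpm, by nlinarith⟩
  · rintro ⟨hpm, hin⟩
    nlinarith

theorem finProdFinEquiv_eq_zero_iff {m n : ℕ} (p : Fin m) (i : Fin n) :
    (finProdFinEquiv (p, i)).val = 0 ↔ p.val = 0 ∧ i.val = 0 := by
  have hn : n ≠ 0 := (i.pos).ne'
  simp [finProdFinEquiv_apply_val, hn, and_comm]

theorem circulantMatrix_finProdFinEquiv {m : ℕ} (p q : Fin m) (i j : Fin k) :
    circulantMatrix a b c m (finProdFinEquiv (p, i)) (finProdFinEquiv (q, j)) =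
      tridiagBlock a b c (q - p) i j
        + (if q.val + 1 = m ∧ p.val = 0 then tridiagBlock a b c (-1) i j else 0)
        + (if p.val + 1 = m ∧ q.val = 0 then tridiagBlock a b c 1 i j else 0) := by
  have hT : toeplitzMatrix a b c m (finProdFinEquiv (p, i)) (finProdFinEquiv (q, j)) =
      tridiagBlock a b c (q - p) i j := by
    rw [← tridiagEntry_block]
    simp only [toeplitzMatrix, Matrix.of_apply, finProdFinEquiv_apply_val, Nat.cast_add,
      Nat.cast_mul, add_comm, mul_comm]
  simp only [circulantMatrix, Matrix.of_apply, hT, finProdFinEquiv_add_one_eq_mul_iff,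
    finProdFinEquiv_eq_zero_iff, tridiagBlock_neg_one_apply, tridiagBlock_one_apply, ← ite_and]
  grind

theorem circulantMatrix_eq_reindex_comp (m : ℕ) :
    circulantMatrix a b c m =
      Matrix.reindex ((Equiv.prodComm _ _).trans finProdFinEquiv)
        ((Equiv.prodComm _ _).trans finProdFinEquiv)
        (Matrix.comp _ _ _ _ ℂ (symbolAt a b c (cyclicShift m) (star (cyclicShift m)))) := by
  refine (Equiv.symm_apply_eq _).1 ?_
  ext ⟨i, p⟩ ⟨j, q⟩
  refine (circulantMatrix_finProdFinEquiv a b c p q i j).trans ?_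
  rw [tridiagBlock_eq_ite]
  simp only [Matrix.comp_apply, symbolAt, Matrix.of_apply, Matrix.add_apply, Matrix.smul_apply,
    Matrix.algebraMap_matrix_apply, cyclicShift_apply, star_cyclicShift_apply]
  have h0 : (q : ℤ) - (p : ℤ) = 0 ↔ p = q := by rw [Fin.ext_iff]; omega
  have h1 : (q : ℤ) - (p : ℤ) = -1 ↔ q.val + 1 = p := by omega
  have h2 : (q : ℤ) - (p : ℤ) = 1 ↔ p.val + 1 = q := by omega
  simp only [h0, h1, h2, Matrix.ite_apply, Matrix.zero_apply, Algebra.algebraMap_self_apply,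
    smul_eq_mul, mul_ite, mul_one, mul_zero]
  grind

open scoped Matrix.Norms.L2Operator in
theorem spectrum_circulantMatrix_eq_biUnion (m : ℕ) :
    spectrum ℂ (circulantMatrix a b c m) =
      ⋃ z ∈ spectrum ℂ (cyclicShift m), spectrum ℂ (symbol a b c z) := by
  rw [← spectrum_symbolAt_of_mem_unitary a b c (cyclicShift_mem_unitary m),
    circulantMatrix_eq_reindex_comp, ← Matrix.coe_reindexAlgEquiv ℂ, AlgEquiv.spectrum_eq,
    ← Matrix.compAlgEquiv_apply _ _ _ ℂ, AlgEquiv.spectrum_eq]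

theorem cyclicShift_pow_self (m : ℕ) : cyclicShift m ^ m = 1 := by
  obtain _ | m := m
  · rfl
  have hpow (n : ℕ) (p : Fin (m + 1)) : (finRotate (m + 1) ^ n) p = p + n • 1 := by
    induction n with
    | zero => simp
    | succ n ih =>
      rw [pow_succ', Equiv.Perm.mul_apply, ih, finRotate_apply, succ_nsmul, add_assoc]
  have hself : finRotate (m + 1) ^ (m + 1) = 1 := Equiv.ext fun p => by
    simpa [hpow] using card_nsmul_eq_zero (x := (1 : Fin (m + 1)))
  change Matrix.permMatrixHom (finRotate (m + 1)) ^ (m + 1) = (1 : Matrix _ _ ℂ)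
  rw [← map_pow, hself, map_one]

theorem cyclicShift_mulVec_pow {m : ℕ} {w : ℂ} (hw : w ^ m = 1) :
    (cyclicShift m).mulVec (fun p => w ^ p.val) = w⁻¹ • fun p : Fin m => w ^ p.val := by
  rw [cyclicShift, Matrix.permMatrix_mulVec]
  funext p
  obtain ⟨q, rfl⟩ := (finRotate m).surjective p
  have hw0 : w ≠ 0 := by
    rintro rfl
    exact zero_ne_one ((zero_pow q.pos.ne').symm.trans hw)
  have hstep : w ^ (finRotate m q).val = w * w ^ q.val := by
    rcases (finRotate_eq_iff q _).1 rfl with h | ⟨h, h0⟩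
    · rw [← h, pow_succ']
    · rw [h0, pow_zero, ← pow_succ', h, hw]
  calc w ^ ((finRotate m)⁻¹ (finRotate m q)).val = w ^ q.val := by
        rw [Equiv.Perm.inv_def, Equiv.symm_apply_apply]
    _ = w⁻¹ * w ^ (finRotate m q).val := by rw [hstep, inv_mul_cancel_left₀ hw0]

theorem spectrum_cyclicShift {m : ℕ} (hm : 0 < m) :
    spectrum ℂ (cyclicShift m) = {z | z ^ m = 1} := by
  have : NeZero m := NeZero.of_pos hm
  refine Set.Subset.antisymm (fun z hz => ?_) fun z (hz : z ^ m = 1) => ?_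
  · simpa [cyclicShift_pow_self] using spectrum.pow_mem_pow (cyclicShift m) m hz
  · have hv : Module.End.HasEigenvector (Matrix.toLin' (cyclicShift m)) z fun p => z⁻¹ ^ p.val := by
      refine ⟨Module.End.mem_eigenspace_iff.2 ?_, fun h => ?_⟩
      · rw [Matrix.toLin'_apply, cyclicShift_mulVec_pow (by rw [inv_pow, hz, inv_one]), inv_inv]
      · simpa using congrFun h 0
    rw [← Matrix.spectrum_toLin']
    exact (Module.End.hasEigenvalue_of_hasEigenvector hv).mem_spectrum

theorem spectrum_circulantMatrix {m : ℕ} (hm : 0 < m) :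
    spectrum ℂ (circulantMatrix a b c m) =
      ⋃ z ∈ {z : ℂ | z ^ m = 1}, spectrum ℂ (symbol a b c z) := by
  rw [spectrum_circulantMatrix_eq_biUnion, spectrum_cyclicShift hm]

theorem tendsto_hausdorffEDist_spectrum_circulantMatrix :
    Filter.Tendsto (fun m : ℕ => Metric.hausdorffEDist (spectrum ℂ (circulantMatrix a b c m))
      (⋃ z ∈ Metric.sphere (0 : ℂ) 1, spectrum ℂ (symbol a b c z))) Filter.atTop (nhds 0) := by
  have hcont : ContinuousOn (symbol a b c) (Metric.sphere 0 1) :=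
    (continuousOn_symbol a b c).mono fun z hz => ne_zero_of_mem_unit_sphere ⟨z, hz⟩
  have hpos : ∀ᶠ m : ℕ in Filter.atTop, 0 < m := Filter.eventually_gt_atTop 0
  refine (tendsto_hausdorffEDist_biUnion_spectrum (isCompact_sphere 0 1) hcont
    (hpos.mono fun m hm => setOf_pow_eq_one_subset_sphere hm)
    tendsto_hausdorffEDist_setOf_pow_eq_one).congr' (hpos.mono fun m hm => ?_)
  exact congrArg (Metric.hausdorffEDist · _) (spectrum_circulantMatrix a b c hm).symm

end Circulant

section Laurent

open scoped lp

/-- The bilateral shift `(bilateralShift x) n = x (n - 1)`. -/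
noncomputable def bilateralShift : ℓ²(ℤ, ℂ) →L[ℂ] ℓ²(ℤ, ℂ) :=
  (lpReindex ℂ (Equiv.subRight (1 : ℤ)) : ℓ²(ℤ, ℂ) ≃ₗᵢ[ℂ] ℓ²(ℤ, ℂ))

theorem bilateralShift_apply (x : ℓ²(ℤ, ℂ)) (n : ℤ) : bilateralShift x n = x (n - 1) := rfl

theorem star_bilateralShift_apply (x : ℓ²(ℤ, ℂ)) (n : ℤ) :
    star bilateralShift x n = x (n + 1) := by
  rw [bilateralShift, LinearIsometryEquiv.star_eq_symm]
  rfl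

theorem bilateralShift_mem_unitary : bilateralShift ∈ unitary (ℓ²(ℤ, ℂ) →L[ℂ] ℓ²(ℤ, ℂ)) :=
  Unitary.mem_iff.2 ⟨by ext; simp [star_bilateralShift_apply, bilateralShift_apply],
    by ext; simp [star_bilateralShift_apply, bilateralShift_apply]⟩

theorem spectrum_bilateralShift : spectrum ℂ bilateralShift = Metric.sphere (0 : ℂ) 1 := by
  refine (spectrum.subset_circle_of_unitary bilateralShift_mem_unitary).antisymm
    fun z hz hunit => ?_
  rw [mem_sphere_zero_iff_norm] at hz
  have hsurj := (ContinuousLinearMap.isUnit_iff_bijective.1 hunit).2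
  obtain ⟨x, hx⟩ := hsurj (lp.single 2 0 1)
  have hrec (n : ℤ) : z * x n - x (n - 1) = Pi.single (M := fun _ => ℂ) 0 1 n := by
    rw [← lp.coeFn_single, ← hx, Algebra.algebraMap_eq_smul_one]
    rfl
  -- `‖x n‖` is constant on `n ≥ 0` and on `n < 0`, hence `0`; but `z * x 0 - x (-1) = 1`
  have hstep {n : ℤ} (hn : n ≠ 0) : ‖x n‖ = ‖x (n - 1)‖ := by
    have h := hrec n
    rw [Pi.single_eq_of_ne hn, sub_eq_zero] at h
    rw [← h, norm_mul, hz, one_mul]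
  have hpos (n : ℕ) : ‖x n‖ = ‖x 0‖ := by
    induction n with
    | zero => rfl
    | succ n ih => rw [hstep (by omega), Nat.cast_succ, add_sub_cancel_right, ih]
  have hneg (n : ℕ) : ‖x (-1 - n)‖ = ‖x (-1)‖ := by
    induction n with
    | zero => simp
    | succ n ih => rw [Nat.cast_succ, ← sub_sub, ← hstep (by omega), ih]
  have h0 := eq_zero_of_forall_norm_lp_eq (by simp) Nat.cast_injective hpos
  have h1 := eq_zero_of_forall_norm_lp_eq (by simp)
    (fun m n : ℕ => by simp) hneg
  simpa [norm_eq_zero.1 h0, norm_eq_zero.1 h1] using hrec 0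

variable {k : ℕ} [NeZero k] (a b c : Fin k → ℂ)

theorem symbolAt_bilateralShift_apply (i j : Fin k) (x : ℓ²(ℤ, ℂ)) (n : ℤ) :
    symbolAt a b c bilateralShift (star bilateralShift) i j x n =
      tridiagBlock a b c 0 i j * x n + tridiagBlock a b c (-1) i j * x (n - 1)
        + tridiagBlock a b c 1 i j * x (n + 1) := by
  rw [← bilateralShift_apply, ← star_bilateralShift_apply, symbolAt, Matrix.of_apply,
    Algebra.algebraMap_eq_smul_one]
  rfl

theorem lpBlock_conj_laurentOperator :
    (lpBlock ℂ (Int.divModEquiv k).symm).conjContinuousAlgEquiv (laurentOperator a b c) =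
      matrixCLMAlgEquiv ℂ ℓ²(ℤ, ℂ) (Fin k)
        (symbolAt a b c bilateralShift (star bilateralShift)) := by
  refine ContinuousLinearMap.ext fun y => ?_
  obtain ⟨x, rfl⟩ := (lpBlock ℂ (Int.divModEquiv k).symm).surjective y
  ext i q
  rw [ContinuousLinearEquiv.conjContinuousAlgEquiv_apply_apply,
    ContinuousLinearEquiv.symm_apply_apply]
  refine (sum_tridiagEntry_mul a b c x q i).trans ?_
  rw [matrixCLMAlgEquiv_apply, lp.coeFn_sum, Finset.sum_apply]
  exact Finset.sum_congr rfl fun j _ =>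
    (symbolAt_bilateralShift_apply a b c i j (lpBlock ℂ (Int.divModEquiv k).symm x j) q).symm

theorem spectrum_laurentOperator :
    spectrum ℂ (laurentOperator a b c) =
      ⋃ z ∈ Metric.sphere (0 : ℂ) 1, spectrum ℂ (symbol a b c z) := by
  rw [← AlgEquiv.spectrum_eq
      (lpBlock (E := ℂ) (p := 2) ℂ (Int.divModEquiv k).symm).conjContinuousAlgEquiv,
    lpBlock_conj_laurentOperator, AlgEquiv.spectrum_eq,
    spectrum_symbolAt_of_mem_unitary a b c bilateralShift_mem_unitary, spectrum_bilateralShift]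

end Laurent

theorem image_exp_brillouinZone {ℓ : ℝ} (hℓ : 0 < ℓ) :
    (fun α : ℝ => Complex.exp (-Complex.I * ℓ * α)) '' brillouinZone ℓ = Metric.sphere 0 1 := by
  refine Set.Subset.antisymm ?_ fun z hz => ?_
  · rintro _ ⟨α, -, rfl⟩
    rw [mem_sphere_zero_iff_norm, Complex.norm_exp]
    simp
  · rw [mem_sphere_zero_iff_norm] at hz
    refine ⟨-z.arg / ℓ, ⟨?_, ?_⟩, ?_⟩
    · exact div_le_div_of_nonneg_right (neg_le_neg z.arg_le_pi) hℓ.le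
    · exact div_lt_div_of_pos_right (neg_lt.1 z.neg_pi_lt_arg) hℓ
    · have hℓ0 : (ℓ : ℂ) ≠ 0 := Complex.ofReal_ne_zero.2 hℓ.ne'
      have harg : -Complex.I * ℓ * (-z.arg / ℓ : ℝ) = z.arg * Complex.I := by
        push_cast
        field_simp
      have hpolar := Complex.norm_mul_exp_arg_mul_I z
      rwa [hz, Complex.ofReal_one, one_mul, ← harg] at hpolar

theorem mainTheorem4 (k : ℕ) [NeZero k] (a b c : Fin k → ℂ) (ℓ : ℝ) (hℓ : 0 < ℓ) :
    (∀ m : ℕ, 0 < m →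
      spectrum ℂ (circulantMatrix a b c m) =
        ⋃ j ∈ Finset.range m,
          spectrum ℂ (symbol a b c (Complex.exp (2 * Real.pi * Complex.I * j / m)))) ∧
    Filter.Tendsto
      (fun m : ℕ => Metric.hausdorffEDist (spectrum ℂ (circulantMatrix a b c m))
        (⋃ α ∈ brillouinZone ℓ,
          spectrum ℂ (symbol a b c (Complex.exp (-Complex.I * ℓ * α)))))
      Filter.atTop (nhds 0) ∧
    (⋃ α ∈ brillouinZone ℓ, spectrum ℂ (symbol a b c (Complex.exp (-Complex.I * ℓ * α)))) =
      spectrum ℂ (laurentOperator a b c) := by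
  have hzone : ⋃ α ∈ brillouinZone ℓ,
      spectrum ℂ (symbol a b c (Complex.exp (-Complex.I * ℓ * α))) =
        ⋃ z ∈ Metric.sphere 0 1, spectrum ℂ (symbol a b c z) := by
    rw [← image_exp_brillouinZone hℓ, Set.biUnion_image]
  rw [hzone]
  refine ⟨fun m hm => ?_, tendsto_hausdorffEDist_spectrum_circulantMatrix a b c,
    (spectrum_laurentOperator a b c).symm⟩
  rw [spectrum_circulantMatrix a b c hm, setOf_pow_eq_one hm, Set.biUnion_image]
  rfl
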